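/- Let $q,z$ be complex numbers with $|q|<1$ and $z\neq 0$. Write $(A;q)_n=\prod_{i=0}^{n-1}(1-Aq^i)$, $(A;q)_\infty=\prod_{i=0}^{\infty}(1-Aq^i)$, $(A_1,\dots,A_m;q)_n=(A_1;q)_n\cdots(A_m;q)_n$ (for $n$ a non-negative integer or $\infty$), and $(q)_n=(q;q)_n$. **Theorem.** Let $k\ge 0$ and $0\le j\le k+1$ be integers. Then the following multiple series, over all integers $s_1\ge s_2\ge\cdots\ge s_{k+1}\ge 0$, converges absolutely, and $$ \sum_{s_1\ge s_2\ge\cdots\ge s_{k+1}\ge 0} \frac{q^{s_1^2-s_1+\cdots+s_j^2-s_j+s_{j+1}^2+\cdots+s_{k+1}^2}} {(q)_{s_1-s_2}\cdots(q)_{s_k-s_{k+1}}}\, \frac{(-z,-q/z;q)_{s_{k+1}}}{(q)_{2s_{k+1}}} =\sum_{s=0}^{j} \frac{(-zq^{k+1+j-2s},\,-q^{k+2-j+2s}/z,\,q^{2k+3};\,q^{2k+3})_\infty}{(q;q)_\infty}. $$ (Here $0^0=1$ when $q=0$.) -/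

import Mathlib

/-- The finite `q`-shifted factorial `(A; q)_n = ∏_{i=0}^{n-1} (1 - A q^i)`. -/
noncomputable def qPoch (A q : ℂ) (n : ℕ) : ℂ :=
  ∏ i ∈ Finset.range n, (1 - A * q ^ i)

/-- The infinite `q`-shifted factorial `(A; q)_∞ = ∏_{i ≥ 0} (1 - A q^i)`, for `‖q‖ < 1`. -/
noncomputable def qPochInf (A q : ℂ) : ℂ :=
  ∏' i : ℕ, (1 - A * q ^ i)

/-- The product defining `(A; q)_∞` converges for `‖q‖ < 1`, so `qPochInf` is not a junk value. -/
theorem multipliable_qPochInf (A q : ℂ) (hq : ‖q‖ < 1) :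
    Multipliable (fun i : ℕ => 1 - A * q ^ i) := by
  have h : Summable (fun i : ℕ => ‖-(A * q ^ i)‖) := by
    simpa [norm_mul, norm_pow] using
      (summable_geometric_of_lt_one (norm_nonneg q) hq).mul_left ‖A‖
  simpa [sub_eq_add_neg] using multipliable_one_add_of_summable h

/-- The summand of the multiple series at `s_1 ≥ s_2 ≥ ⋯ ≥ s_{k+1} ≥ 0`. The tuple is indexed
from zero: `s i` is `s_{i+1}`, and `s (Fin.last k)` is `s_{k+1}`. -/
noncomputable def overpartitionTerm (k j : ℕ) (q z : ℂ) (s : Fin (k + 1) → ℕ) : ℂ :=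
  q ^ (∑ i : Fin (k + 1), if (i : ℕ) < j then s i ^ 2 - s i else s i ^ 2)
    / (∏ i : Fin k, qPoch q q (s i.castSucc - s i.succ))
    * ((qPoch (-z) q (s (Fin.last k)) * qPoch (-q / z) q (s (Fin.last k)))
      / qPoch q q (2 * s (Fin.last k)))

/-! Bailey chain with a = 1. Write `K r n` for `baileyKernel q r n`, and let A = q^(r²-r), B =
q^(r²+r). The finite Jacobi triple product (`qPoch_neg_mul_qPoch_neg`) expands the innermost factor
as ∑ θ_r K r n. Summing over s against 1/(q)_(n-s) with weight q^(s²) multiplies `K r` by q^(r²).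
Weight q^(s²-s) multiplies it by A + B - q^n q^(r²), which depends on n. The q^n part is harmless:
at the next step q^(s²-s) q^s = q^(s²), so it undergoes the plain step, and since AB = q^(2r²), j
such steps yield h_j(A, B) - q^n q^(r²) h_(j-1)(A, B) by the recurrence of complete homogeneous
polynomials.

As n → ∞ the q^n part vanishes, `K r n` tends to (q)_∞⁻² and the outer 1/(q)_(n-s_1) to (q)_∞⁻¹. The
j + 1 monomials of h_j turn θ_r into the coefficients of j + 1 theta series in base q^(2k+3)
(`sum_thetaCoeff_eq`), and Jacobi's triple product sums each of them. -/

open Filter Topology Finset.HasAntidiagonal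

/-- The reciprocal `1 / (q; q)_n`. -/
noncomputable def qPochRecip (q : ℂ) (n : ℕ) : ℂ :=
  (qPoch q q n)⁻¹

/-- The kernel `1 / ((q; q)_{n-r} (q; q)_{n+r})` of a Bailey pair relative to `a = 1`,
extended by zero to `r > n`. -/
noncomputable def baileyKernel (q : ℂ) (r n : ℕ) : ℂ :=
  if r ≤ n then qPochRecip q (n - r) * qPochRecip q (n + r) else 0

/-- The sum of the terms with indices `r` and `-r` of the two-sided theta series
`∑ x ^ r q ^ (r (r - 1) / 2)`, where `x * y = q`. -/
noncomputable def thetaCoeff (x y q : ℂ) (r : ℕ) : ℂ :=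
  if r = 0 then 1 else q ^ r.choose 2 * (x ^ r + y ^ r)

/-! ### Elementary relations for reciprocals, kernels and theta coefficients -/

theorem one_sub_pow_succ_ne_zero {q : ℂ} (hq : ‖q‖ < 1) (n : ℕ) : 1 - q ^ (n + 1) ≠ 0 := by
  intro h
  have h1 : ‖q ^ (n + 1)‖ = 1 := by rw [← sub_eq_zero.mp h, norm_one]
  rw [norm_pow] at h1
  exact absurd h1 (pow_lt_one₀ (norm_nonneg q) hq n.succ_ne_zero).ne

theorem qPochRecip_zero (q : ℂ) : qPochRecip q 0 = 1 := by
  simp [qPochRecip, qPoch]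

theorem one_sub_pow_mul_qPochRecip {q : ℂ} (hq : ‖q‖ < 1) (n : ℕ) :
    (1 - q ^ (n + 1)) * qPochRecip q (n + 1) = qPochRecip q n := by
  have h := one_sub_pow_succ_ne_zero hq n
  rw [qPochRecip, qPochRecip, qPoch, Finset.prod_range_succ, mul_inv, ← pow_succ', mul_left_comm,
    mul_inv_cancel₀ h, mul_one, qPoch]

theorem baileyKernel_of_lt {q : ℂ} {r n : ℕ} (h : n < r) : baileyKernel q r n = 0 :=
  if_neg (not_le.mpr h)

theorem baileyKernel_add (q : ℂ) (r N : ℕ) :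
    baileyKernel q r (r + N) = qPochRecip q N * qPochRecip q (N + 2 * r) := by
  rw [baileyKernel, if_pos (Nat.le_add_right r N), Nat.add_sub_cancel_left]
  congr 2
  ring

theorem thetaCoeff_succ (x y q : ℂ) (r : ℕ) :
    thetaCoeff x y q (r + 1) = q ^ (r + 1).choose 2 * (x ^ (r + 1) + y ^ (r + 1)) :=
  if_neg r.succ_ne_zero

/-! ### The finite Jacobi triple product -/

/-- Coefficient of θ_0 in the step n → n + 1 of the finite triple product; the 2 arises because
indices 1 and -1 both feed index 0. -/
theorem baileyKernel_succ_zero {q : ℂ} (hq : ‖q‖ < 1) (n : ℕ) :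
    (1 + q ^ (2 * n + 1)) * baileyKernel q 0 n + 2 * q ^ (n + 1) * baileyKernel q 1 n
      = (1 - q ^ (2 * n + 1)) * (1 - q ^ (2 * n + 2)) * baileyKernel q 0 (n + 1) := by
  have h0 := baileyKernel_add q 0 n
  have h0' := baileyKernel_add q 0 (n + 1)
  simp only [zero_add, mul_zero, add_zero] at h0 h0'
  rw [h0, h0', ← one_sub_pow_mul_qPochRecip hq n]
  rcases n with _ | n
  · rw [baileyKernel_of_lt Nat.zero_lt_one]
    ring
  · rw [add_comm n 1, baileyKernel_add, add_comm 1 n, mul_one, ← one_sub_pow_mul_qPochRecip hq n,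
      ← one_sub_pow_mul_qPochRecip hq (n + 1)]
    ring

theorem baileyKernel_succ_succ {q : ℂ} (hq : ‖q‖ < 1) {r n : ℕ} (hr : r ≤ n) :
    (1 + q ^ (2 * n + 1)) * baileyKernel q (r + 1) n + q ^ (n - r) * baileyKernel q r n
        + q ^ (n + r + 2) * baileyKernel q (r + 2) n
      = (1 - q ^ (2 * n + 1)) * (1 - q ^ (2 * n + 2)) * baileyKernel q (r + 1) (n + 1) := by
  obtain ⟨N, rfl⟩ := Nat.exists_eq_add_of_le hr
  have h4 : baileyKernel q (r + 1) (r + N + 1)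
      = qPochRecip q N * qPochRecip q (N + 2 * r + 2) := by
    rw [show r + N + 1 = (r + 1) + N by ring, baileyKernel_add]
    rfl
  rw [h4, baileyKernel_add, Nat.add_sub_cancel_left]
  have e0 := one_sub_pow_mul_qPochRecip hq (N + 2 * r)
  have e1 := one_sub_pow_mul_qPochRecip hq (N + 2 * r + 1)
  rw [← e0, ← e1]
  rcases N with _ | N
  · rw [baileyKernel_of_lt (by omega), baileyKernel_of_lt (by omega)]
    ring
  · have h5 : baileyKernel q (r + 1) (r + (N + 1))
        = qPochRecip q N * qPochRecip q (N + 2 * r + 2) := by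
      rw [show r + (N + 1) = (r + 1) + N by ring, baileyKernel_add]
      rfl
    have e2 := one_sub_pow_mul_qPochRecip hq (N + 2 * r + 2)
    rw [h5, ← one_sub_pow_mul_qPochRecip hq N]
    have h6 : q ^ (r + (N + 1) + r + 2) * baileyKernel q (r + 2) (r + (N + 1))
        = q ^ (r + (N + 1) + r + 2) * ((1 - q ^ N) * (1 - q ^ (N + 1)) * qPochRecip q (N + 1)
          * qPochRecip q (N + 2 * r + 3)) := by
      rcases N with _ | N
      · rw [baileyKernel_of_lt (by omega)]
        ring
      · rw [show r + (N + 1 + 1) = (r + 2) + N by ring, baileyKernel_add,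
          ← one_sub_pow_mul_qPochRecip hq N, ← one_sub_pow_mul_qPochRecip hq (N + 1)]
        ring_nf
    rw [h6, ← e2]
    ring_nf

/-- Comes from (x + y)(x^m + y^m) = x^(m+1) + y^(m+1) + xy(x^(m-1) + y^(m-1)). At r = 0 the last
bracket is 2, whereas `thetaCoeff` is 1 there. -/
theorem pow_mul_add_mul_thetaCoeff_succ {x y q : ℂ} (hxy : x * y = q) {r n : ℕ} (hr : r < n) :
    q ^ n * (x + y) * thetaCoeff x y q (r + 1)
      = q ^ (n - (r + 1)) * thetaCoeff x y q (r + 2)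
        + q ^ (n + r + 1) * (if r = 0 then 2 else thetaCoeff x y q r) := by
  obtain ⟨N, rfl⟩ := Nat.exists_eq_add_of_le (Nat.succ_le_of_lt hr)
  rw [Nat.succ_eq_add_one, Nat.add_sub_cancel_left]
  rcases r with _ | r
  · simp only [thetaCoeff_succ, if_true, ← hxy, Nat.choose_succ_succ]
    norm_num [Nat.choose]
    ring
  · have c1 : (r + 1 + 1).choose 2 = (r + 1).choose 2 + (r + 1) := by
      rw [Nat.choose_succ_succ' (r + 1) 1, Nat.choose_one_right, add_comm]
    have c2 : (r + 1 + 2).choose 2 = (r + 1).choose 2 + (r + 1) + (r + 2) := by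
      rw [Nat.choose_succ_succ' (r + 1 + 1) 1, Nat.choose_one_right, c1]; ring
    rw [if_neg r.succ_ne_zero, thetaCoeff_succ, thetaCoeff_succ, thetaCoeff_succ, c1, c2]
    generalize (r + 1).choose 2 = c
    have h : (x + y) * (x ^ (r + 1 + 1) + y ^ (r + 1 + 1))
        = x ^ (r + 1 + 1 + 1) + y ^ (r + 1 + 1 + 1) + q * (x ^ (r + 1) + y ^ (r + 1)) := by
      rw [← hxy]; ring
    linear_combination q ^ (r + 1 + 1 + N + (c + (r + 1))) * h

theorem qPoch_neg_mul_qPoch_neg {x y q : ℂ} (hq : ‖q‖ < 1) (hxy : x * y = q) (n : ℕ) :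
    qPoch (-x) q n * qPoch (-y) q n * qPochRecip q (2 * n)
      = ∑ r ∈ Finset.range (n + 1), thetaCoeff x y q r * baileyKernel q r n := by
  induction n with
  | zero => simp [qPoch, thetaCoeff, baileyKernel, qPochRecip_zero]
  | succ n ih =>
    have hne : (1 - q ^ (2 * n + 1)) * (1 - q ^ (2 * n + 2)) ≠ 0 :=
      mul_ne_zero (one_sub_pow_succ_ne_zero hq _) (one_sub_pow_succ_ne_zero hq _)
    apply mul_left_cancel₀ hne
    -- The new factors are (1 + xq^n)(1 + yq^n) = 1 + q^(2n+1) + q^n(x + y), by xy = q.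
    have hl : (1 - q ^ (2 * n + 1)) * (1 - q ^ (2 * n + 2)) *
        (qPoch (-x) q (n + 1) * qPoch (-y) q (n + 1) * qPochRecip q (2 * (n + 1)))
        = (1 + q ^ (2 * n + 1) + q ^ n * (x + y)) *
          (qPoch (-x) q n * qPoch (-y) q n * qPochRecip q (2 * n)) := by
      rw [← one_sub_pow_mul_qPochRecip hq (2 * n), ← one_sub_pow_mul_qPochRecip hq (2 * n + 1)]
      simp only [qPoch, Finset.prod_range_succ]
      rw [show 2 * (n + 1) = 2 * n + 1 + 1 by ring]
      linear_combination ((1 - q ^ (2 * n + 1)) * (1 - q ^ (2 * n + 2)) * qPochRecip q (2 * n + 1 + 1)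
        * (∏ i ∈ Finset.range n, (1 - -x * q ^ i)) * (∏ i ∈ Finset.range n, (1 - -y * q ^ i)))
        * (q ^ n) ^ 2 * hxy
    rw [hl, ih]
    set a := thetaCoeff x y q with ha
    have ha0 : a 0 = 1 := if_pos rfl
    have hKn : ∀ r, n < r → baileyKernel q r n = 0 := fun r h => baileyKernel_of_lt h
    -- the three groups of terms, indexed by the coefficient `a (r + 1)`
    have s1 : ∑ r ∈ Finset.range (n + 1), a r * baileyKernel q r n
        = baileyKernel q 0 n
          + ∑ r ∈ Finset.range (n + 1), a (r + 1) * baileyKernel q (r + 1) n := by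
      rw [Finset.sum_range_succ', Finset.sum_range_succ _ n, hKn (n + 1) n.lt_succ_self, ha0]
      ring
    have s2 : ∑ r ∈ Finset.range (n + 1), q ^ n * (x + y) * (a r * baileyKernel q r n)
        = ∑ r ∈ Finset.range (n + 1), q ^ (n - r) * (a (r + 1) * baileyKernel q r n)
          + ∑ r ∈ Finset.range n,
            q ^ (n + r + 1) * ((if r = 0 then 2 else a r) * baileyKernel q (r + 1) n) := by
      rw [Finset.sum_range_succ', Finset.sum_range_succ' _ n, add_right_comm,
        ← Finset.sum_add_distrib]
      congr 1
      · refine Finset.sum_congr rfl fun r hr => ?_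
        have := pow_mul_add_mul_thetaCoeff_succ hxy (Finset.mem_range.mp hr)
        linear_combination baileyKernel q (r + 1) n * this
      · rw [ha0, ha, thetaCoeff_succ]
        simp [mul_assoc]
    have s3 : ∑ r ∈ Finset.range n,
          q ^ (n + r + 1) * ((if r = 0 then 2 else a r) * baileyKernel q (r + 1) n)
        = 2 * q ^ (n + 1) * baileyKernel q 1 n
          + ∑ r ∈ Finset.range (n + 1), q ^ (n + r + 2) * (a (r + 1) * baileyKernel q (r + 2) n) := by
      have h1 : ∑ r ∈ Finset.range n,
          q ^ (n + r + 1) * ((if r = 0 then 2 else a r) * baileyKernel q (r + 1) n)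
          = ∑ r ∈ Finset.range (n + 1),
          q ^ (n + r + 1) * ((if r = 0 then 2 else a r) * baileyKernel q (r + 1) n) := by
        rw [Finset.sum_range_succ _ n, hKn (n + 1) n.lt_succ_self]
        ring
      rw [h1, Finset.sum_range_succ', Finset.sum_range_succ _ n, hKn (n + 2) (by omega), add_comm]
      simp only [if_true, Nat.succ_ne_zero, if_false]
      congr 1
      · ring
      · simp only [mul_zero, add_zero]
        exact Finset.sum_congr rfl fun r _ => by ring
    rw [add_mul, Finset.mul_sum _ _ (q ^ n * (x + y)), s2, s3, s1,
      Finset.sum_range_succ' _ (n + 1), ha0, one_mul]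
    have k0 := baileyKernel_succ_zero hq n
    have k1 : ∑ r ∈ Finset.range (n + 1), (1 - q ^ (2 * n + 1)) * (1 - q ^ (2 * n + 2))
          * (a (r + 1) * baileyKernel q (r + 1) (n + 1))
        = (1 + q ^ (2 * n + 1)) * ∑ r ∈ Finset.range (n + 1), a (r + 1) * baileyKernel q (r + 1) n
          + ∑ r ∈ Finset.range (n + 1), q ^ (n - r) * (a (r + 1) * baileyKernel q r n)
          + ∑ r ∈ Finset.range (n + 1), q ^ (n + r + 2) * (a (r + 1) * baileyKernel q (r + 2) n) := by
      rw [Finset.mul_sum, ← Finset.sum_add_distrib, ← Finset.sum_add_distrib]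
      refine Finset.sum_congr rfl fun r hr => ?_
      have := baileyKernel_succ_succ hq (Nat.lt_succ_iff.mp (Finset.mem_range.mp hr))
      linear_combination -a (r + 1) * this
    rw [mul_add _ (Finset.sum _ _), Finset.mul_sum, k1]
    linear_combination k0

/-! ### The Bailey lemma -/

theorem sum_antidiagonal_qPochRecip_succ {q : ℂ} (hq : ‖q‖ < 1) (N : ℕ) (g : ℕ → ℂ) :
    ∑ p ∈ antidiagonal (N + 1),
        (1 - q ^ p.1) * (qPochRecip q p.1 * qPochRecip q p.2 * g p.2)
      = ∑ p ∈ antidiagonal N, qPochRecip q p.1 * qPochRecip q p.2 * g p.2 := by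
  rw [Finset.Nat.sum_antidiagonal_succ]
  simp only [pow_zero, sub_self, zero_mul, zero_add]
  refine Finset.sum_congr rfl fun p _ => ?_
  rw [← one_sub_pow_mul_qPochRecip hq p.1]
  ring

theorem sum_antidiagonal_qPochRecip_succ' {q : ℂ} (hq : ‖q‖ < 1) (N : ℕ) (g : ℕ → ℂ) :
    ∑ p ∈ antidiagonal (N + 1),
        (1 - q ^ p.2) * (qPochRecip q p.1 * qPochRecip q p.2 * g p.2)
      = ∑ p ∈ antidiagonal N, qPochRecip q p.1 * qPochRecip q p.2 * g (p.2 + 1) := by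
  rw [Finset.Nat.sum_antidiagonal_succ']
  simp only [pow_zero, sub_self, zero_mul, zero_add]
  refine Finset.sum_congr rfl fun p _ => ?_
  rw [← one_sub_pow_mul_qPochRecip hq p.2]
  ring

/-- A limiting case of the `q`-Chu–Vandermonde sum. -/
theorem sum_antidiagonal_qPochRecip {q : ℂ} (hq : ‖q‖ < 1) (N m : ℕ) :
    ∑ p ∈ antidiagonal N,
        qPochRecip q p.1 * qPochRecip q p.2 * (q ^ (p.2 * (p.2 + m)) * qPochRecip q (p.2 + m))
      = qPochRecip q N * qPochRecip q (N + m) := by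
  induction N generalizing m with
  | zero => simp [qPochRecip_zero]
  | succ N ih =>
    apply mul_left_cancel₀ (one_sub_pow_succ_ne_zero hq N)
    have h1 := sum_antidiagonal_qPochRecip_succ hq N
      (fun b => q ^ (b * (b + m)) * qPochRecip q (b + m))
    -- `N + 1 - b` is the first index, written through b because the weight may depend on b only.
    have h2 := sum_antidiagonal_qPochRecip_succ' hq N
      (fun b => q ^ (N + 1 - b + b * (b + m)) * qPochRecip q (b + m))
    have h3 : ∑ p ∈ antidiagonal N, qPochRecip q p.1 * qPochRecip q p.2 *
          (q ^ (N + 1 - (p.2 + 1) + (p.2 + 1) * (p.2 + 1 + m)) * qPochRecip q (p.2 + 1 + m))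
        = q ^ (N + 1 + m) * ∑ p ∈ antidiagonal N, qPochRecip q p.1 * qPochRecip q p.2 *
          (q ^ (p.2 * (p.2 + (m + 1))) * qPochRecip q (p.2 + (m + 1))) := by
      rw [Finset.mul_sum]
      refine Finset.sum_congr rfl fun p hp => ?_
      have hp' : p.1 + p.2 = N := Finset.HasAntidiagonal.mem_antidiagonal.mp hp
      rw [← hp', show p.1 + p.2 + 1 - (p.2 + 1) = p.1 by omega,
        show p.2 + 1 + m = p.2 + (m + 1) by ring]
      ring
    -- Splits 1 - q^(a+b) = (1 - q^a) + q^a(1 - q^b); the two parts are the cases m and m + 1 at N.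
    have h4 : (1 - q ^ (N + 1)) * ∑ p ∈ antidiagonal (N + 1),
          qPochRecip q p.1 * qPochRecip q p.2 * (q ^ (p.2 * (p.2 + m)) * qPochRecip q (p.2 + m))
        = ∑ p ∈ antidiagonal (N + 1), (1 - q ^ p.1) * (qPochRecip q p.1 * qPochRecip q p.2 *
            (q ^ (p.2 * (p.2 + m)) * qPochRecip q (p.2 + m)))
          + ∑ p ∈ antidiagonal (N + 1), (1 - q ^ p.2) * (qPochRecip q p.1 *
            qPochRecip q p.2 * (q ^ (N + 1 - p.2 + p.2 * (p.2 + m)) * qPochRecip q (p.2 + m))) := by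
      rw [Finset.mul_sum, ← Finset.sum_add_distrib]
      refine Finset.sum_congr rfl fun p hp => ?_
      have hp' : p.1 + p.2 = N + 1 := Finset.HasAntidiagonal.mem_antidiagonal.mp hp
      rw [← hp', Nat.add_sub_cancel]
      ring
    rw [h4, h1, h2, h3, ih, ih, ← one_sub_pow_mul_qPochRecip hq N,
      show N + (m + 1) = N + m + 1 by ring, show N + 1 + m = N + m + 1 by ring,
      ← one_sub_pow_mul_qPochRecip hq (N + m)]
    ring

/-- Split 1 = q^b + (1 - q^b): the first part is the previous sum, the second shifts b and becomes
that sum at N - 1, m + 1. -/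
theorem sum_antidiagonal_qPochRecip_sub {q : ℂ} (hq : ‖q‖ < 1) (N m : ℕ) :
    ∑ p ∈ antidiagonal N,
        qPochRecip q p.1 * qPochRecip q p.2 *
          (q ^ (p.2 * (p.2 + m) - p.2) * qPochRecip q (p.2 + m))
      = (1 + q ^ m - q ^ (N + m)) * (qPochRecip q N * qPochRecip q (N + m)) := by
  have h4 : ∑ p ∈ antidiagonal N, (1 - q ^ p.2) * (qPochRecip q p.1 * qPochRecip q p.2 *
          (q ^ (p.2 * (p.2 + m) - p.2) * qPochRecip q (p.2 + m)))
        = ∑ p ∈ antidiagonal N, qPochRecip q p.1 * qPochRecip q p.2 *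
          (q ^ (p.2 * (p.2 + m) - p.2) * qPochRecip q (p.2 + m))
          - qPochRecip q N * qPochRecip q (N + m) := by
    rw [← sum_antidiagonal_qPochRecip hq, ← Finset.sum_sub_distrib]
    refine Finset.sum_congr rfl fun p _ => ?_
    have h : q ^ (p.2 * (p.2 + m)) = q ^ (p.2 * (p.2 + m) - p.2) * q ^ p.2 := by
      rw [← pow_add, Nat.sub_add_cancel]
      rcases p.2 with _ | b
      · simp
      · exact Nat.le_mul_of_pos_right _ (by omega)
    rw [h]
    ring
  suffices ∑ p ∈ antidiagonal N, (1 - q ^ p.2) * (qPochRecip q p.1 * qPochRecip q p.2 *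
          (q ^ (p.2 * (p.2 + m) - p.2) * qPochRecip q (p.2 + m)))
        = q ^ m * (1 - q ^ N) * (qPochRecip q N * qPochRecip q (N + m)) by
    rw [h4] at this
    linear_combination this
  rcases N with _ | N
  · simp
  · rw [sum_antidiagonal_qPochRecip_succ' hq N
      (fun b => q ^ (b * (b + m) - b) * qPochRecip q (b + m))]
    have h3 : ∑ p ∈ antidiagonal N, qPochRecip q p.1 * qPochRecip q p.2 *
          (q ^ ((p.2 + 1) * (p.2 + 1 + m) - (p.2 + 1)) * qPochRecip q (p.2 + 1 + m))
        = q ^ m * ∑ p ∈ antidiagonal N, qPochRecip q p.1 * qPochRecip q p.2 *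
          (q ^ (p.2 * (p.2 + (m + 1))) * qPochRecip q (p.2 + (m + 1))) := by
      rw [Finset.mul_sum]
      refine Finset.sum_congr rfl fun p hp => ?_
      have : (p.2 + 1) * (p.2 + 1 + m) - (p.2 + 1) = m + p.2 * (p.2 + (m + 1)) := by
        rw [Nat.sub_eq_iff_eq_add (Nat.le_mul_of_pos_right _ (by omega))]
        ring
      rw [this, show p.2 + 1 + m = p.2 + (m + 1) by ring]
      ring
    rw [h3, sum_antidiagonal_qPochRecip hq, ← one_sub_pow_mul_qPochRecip hq N,
      show N + (m + 1) = N + 1 + m by ring]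
    ring

theorem sum_baileyKernel_eq (q : ℂ) (g : ℕ → ℂ) (r N : ℕ) :
    ∑ s ∈ Finset.range (r + N + 1), qPochRecip q (r + N - s) * (g s * baileyKernel q r s)
      = ∑ p ∈ antidiagonal N,
        qPochRecip q p.1 * qPochRecip q p.2 * (g (r + p.2) * qPochRecip q (p.2 + 2 * r)) := by
  rw [add_assoc, Finset.sum_range_add, Finset.sum_eq_zero, zero_add,
    ← Finset.Nat.sum_antidiagonal_swap, Finset.Nat.sum_antidiagonal_eq_sum_range_succ_mk]
  · refine Finset.sum_congr rfl fun t _ => ?_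
    simp only [Prod.swap_prod_mk]
    rw [baileyKernel_add, Nat.add_sub_add_left]
    ring
  · intro s hs
    rw [baileyKernel_of_lt (Finset.mem_range.mp hs), mul_zero, mul_zero]

/-- With s = r + t one has s² = r² + t(t + 2r), so this is the Vandermonde sum with m = 2r. -/
theorem sum_pow_sq_mul_baileyKernel {q : ℂ} (hq : ‖q‖ < 1) (r n : ℕ) :
    ∑ s ∈ Finset.range (n + 1), qPochRecip q (n - s) * (q ^ s ^ 2 * baileyKernel q r s)
      = q ^ r ^ 2 * baileyKernel q r n := by
  rcases lt_or_ge n r with h | h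
  · rw [baileyKernel_of_lt h, mul_zero]
    refine Finset.sum_eq_zero fun s hs => ?_
    rw [baileyKernel_of_lt ((Nat.lt_succ_iff.mp (Finset.mem_range.mp hs)).trans_lt h)]
    ring
  · obtain ⟨N, rfl⟩ := Nat.exists_eq_add_of_le h
    rw [sum_baileyKernel_eq q (fun s => q ^ s ^ 2), baileyKernel_add,
      ← sum_antidiagonal_qPochRecip hq, Finset.mul_sum]
    exact Finset.sum_congr rfl fun p _ => by ring

theorem sum_pow_sq_sub_mul_baileyKernel {q : ℂ} (hq : ‖q‖ < 1) (r n : ℕ) :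
    ∑ s ∈ Finset.range (n + 1), qPochRecip q (n - s) * (q ^ (s ^ 2 - s) * baileyKernel q r s)
      = (q ^ (r ^ 2 - r) + q ^ (r ^ 2 + r) - q ^ n * q ^ r ^ 2) * baileyKernel q r n := by
  rcases lt_or_ge n r with h | h
  · rw [baileyKernel_of_lt h, mul_zero]
    refine Finset.sum_eq_zero fun s hs => ?_
    rw [baileyKernel_of_lt ((Nat.lt_succ_iff.mp (Finset.mem_range.mp hs)).trans_lt h)]
    ring
  · obtain ⟨N, rfl⟩ := Nat.exists_eq_add_of_le h
    rw [sum_baileyKernel_eq q (fun s => q ^ (s ^ 2 - s)), baileyKernel_add]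
    have hr : r ^ 2 = r ^ 2 - r + r := (Nat.sub_add_cancel (Nat.le_self_pow two_ne_zero r)).symm
    have h := sum_antidiagonal_qPochRecip_sub hq N (2 * r)
    trans q ^ (r ^ 2 - r) * ((1 + q ^ (2 * r) - q ^ (N + 2 * r)) *
      (qPochRecip q N * qPochRecip q (N + 2 * r)))
    · rw [← h, Finset.mul_sum]
      refine Finset.sum_congr rfl fun p _ => ?_
      have e : (r + p.2) ^ 2 - (r + p.2) = r ^ 2 - r + (p.2 * (p.2 + 2 * r) - p.2) := by
        have h1 : r ≤ r ^ 2 := Nat.le_self_pow two_ne_zero r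
        have h2 : p.2 ≤ p.2 * (p.2 + 2 * r) := by
          rcases p.2 with _ | b
          · simp
          · exact Nat.le_mul_of_pos_right _ (by omega)
        have h3 : (r + p.2) ^ 2 = r ^ 2 + p.2 * (p.2 + 2 * r) := by ring
        omega
      rw [e, pow_add]
      ring
    · generalize r ^ 2 - r = e at hr
      rw [hr]
      ring

/-! ### Iterating the Bailey lemma -/

/-- The complete homogeneous polynomial of degree `j` in `q ^ (r ^ 2 - r)` and `q ^ (r ^ 2 + r)`. -/
noncomputable def homogSum (q : ℂ) (r j : ℕ) : ℂ :=
  ∑ i ∈ Finset.range (j + 1), (q ^ (r ^ 2 - r)) ^ i * (q ^ (r ^ 2 + r)) ^ (j - i)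

/-- `q ^ r ^ 2` times the preceding `homogSum`, read as zero for `j = 0`. -/
noncomputable def homogSumPred (q : ℂ) (r : ℕ) : ℕ → ℂ
  | 0 => 0
  | j + 1 => q ^ r ^ 2 * homogSum q r j

/-- The value at `n` of the sequence obtained from the finite Jacobi triple product by `e` Bailey
steps with weight `q ^ s ^ 2` followed by `j` steps with weight `q ^ (s ^ 2 - s)`. -/
noncomputable def baileySum (x y q : ℂ) (e j n : ℕ) : ℂ :=
  ∑ r ∈ Finset.range (n + 1), thetaCoeff x y q r *
    (q ^ (e * r ^ 2) * homogSum q r j - q ^ n * (q ^ (e * r ^ 2) * homogSumPred q r j)) *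
      baileyKernel q r n

theorem homogSum_zero (q : ℂ) (r : ℕ) : homogSum q r 0 = 1 := by
  simp [homogSum]

theorem homogSum_succ (q : ℂ) (r j : ℕ) :
    homogSum q r (j + 1) = q ^ (r ^ 2 + r) * homogSum q r j + (q ^ (r ^ 2 - r)) ^ (j + 1) := by
  rw [homogSum, homogSum, Finset.sum_range_succ, Nat.sub_self, pow_zero, mul_one, Finset.mul_sum]
  congr 1
  refine Finset.sum_congr rfl fun i hi => ?_
  rw [Nat.succ_sub (Nat.lt_succ_iff.mp (Finset.mem_range.mp hi)), Nat.succ_eq_add_one,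
    pow_succ]
  ring

/-- The recurrence h_(j+1) = (A + B)h_j - AB h_(j-1), with AB = q^(2r²) shared between the explicit
factor and `homogSumPred`. -/
theorem homogSum_succ_eq (q : ℂ) (r j : ℕ) :
    homogSum q r (j + 1) = (q ^ (r ^ 2 - r) + q ^ (r ^ 2 + r)) * homogSum q r j
      - q ^ r ^ 2 * homogSumPred q r j := by
  have h : q ^ (r ^ 2 - r) * q ^ (r ^ 2 + r) = q ^ r ^ 2 * q ^ r ^ 2 := by
    rw [← pow_add, ← pow_add]
    have : r ≤ r ^ 2 := Nat.le_self_pow two_ne_zero r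
    congr 1
    omega
  rcases j with _ | j
  · rw [homogSum_succ, homogSum_zero, homogSumPred]
    ring
  · rw [homogSum_succ q r (j + 1), homogSumPred, ← mul_assoc, ← h, homogSum_succ]
    ring

/-- Since the kernel vanishes for r > s, the sums interchange; q^s joins the weight of the
correction `d`. -/
theorem sum_qPochRecip_mul_sum_baileyKernel (q : ℂ) (w a b d : ℕ → ℂ) (n : ℕ) :
    ∑ s ∈ Finset.range (n + 1), qPochRecip q (n - s) * (w s *
        ∑ r ∈ Finset.range (s + 1), a r * (b r - q ^ s * d r) * baileyKernel q r s)
      = ∑ r ∈ Finset.range (n + 1), a r *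
        (b r * ∑ s ∈ Finset.range (n + 1), qPochRecip q (n - s) * (w s * baileyKernel q r s)
          - d r * ∑ s ∈ Finset.range (n + 1),
            qPochRecip q (n - s) * (w s * q ^ s * baileyKernel q r s)) := by
  have h : ∀ s ∈ Finset.range (n + 1), qPochRecip q (n - s) * (w s *
      ∑ r ∈ Finset.range (s + 1), a r * (b r - q ^ s * d r) * baileyKernel q r s)
      = ∑ r ∈ Finset.range (n + 1),
        qPochRecip q (n - s) * (w s * (a r * (b r - q ^ s * d r) * baileyKernel q r s)) := by
    intro s hs
    rw [Finset.mul_sum, Finset.mul_sum]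
    refine Finset.sum_subset (Finset.range_subset_range.mpr (Finset.mem_range.mp hs)) fun r _ hr => ?_
    rw [baileyKernel_of_lt (by simpa [Nat.lt_succ_iff] using hr)]
    ring
  rw [Finset.sum_congr rfl h, Finset.sum_comm]
  refine Finset.sum_congr rfl fun r _ => ?_
  rw [Finset.mul_sum, Finset.mul_sum, ← Finset.sum_sub_distrib, Finset.mul_sum]
  exact Finset.sum_congr rfl fun s _ => by ring

theorem sum_pow_sq_mul_baileySum {q : ℂ} (hq : ‖q‖ < 1) (x y : ℂ) (e n : ℕ) :
    ∑ s ∈ Finset.range (n + 1), qPochRecip q (n - s) * (q ^ s ^ 2 * baileySum x y q e 0 s)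
      = baileySum x y q (e + 1) 0 n := by
  simp only [baileySum]
  rw [sum_qPochRecip_mul_sum_baileyKernel]
  refine Finset.sum_congr rfl fun r _ => ?_
  rw [sum_pow_sq_mul_baileyKernel hq, homogSumPred]
  ring

theorem sum_pow_sq_sub_mul_baileySum {q : ℂ} (hq : ‖q‖ < 1) (x y : ℂ) (e j n : ℕ) :
    ∑ s ∈ Finset.range (n + 1), qPochRecip q (n - s) * (q ^ (s ^ 2 - s) * baileySum x y q e j s)
      = baileySum x y q e (j + 1) n := by
  simp only [baileySum]
  rw [sum_qPochRecip_mul_sum_baileyKernel]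
  refine Finset.sum_congr rfl fun r _ => ?_
  have h : ∀ s : ℕ, q ^ (s ^ 2 - s) * q ^ s = q ^ s ^ 2 := fun s => by
    rw [← pow_add, Nat.sub_add_cancel (Nat.le_self_pow two_ne_zero s)]
  simp only [h]
  rw [sum_pow_sq_mul_baileyKernel hq, sum_pow_sq_sub_mul_baileyKernel hq, homogSum_succ_eq,
    homogSumPred]
  ring

/-! ### The multiple series -/

/-- The summand of the multiple series in `m` variables with an additional factor
`1 / (q; q)_{n - s 0}`, extended by zero to all `m`-tuples. -/
noncomputable def truncTerm (x y q : ℂ) : (m j n : ℕ) → (Fin m → ℕ) → ℂ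
  | 0, _, n, _ => qPoch (-x) q n * qPoch (-y) q n * qPochRecip q (2 * n)
  | m + 1, j, n, s =>
    if s 0 ≤ n then
      qPochRecip q (n - s 0) * (q ^ (if 0 < j then s 0 ^ 2 - s 0 else s 0 ^ 2) *
        truncTerm x y q m (j - 1) (s 0) (Fin.tail s))
    else 0

theorem truncTerm_eq_zero (x y q : ℂ) {k : ℕ} (j n : ℕ) {s : Fin (k + 1) → ℕ}
    (h : ¬ (s 0 ≤ n ∧ Antitone s)) : truncTerm x y q (k + 1) j n s = 0 := by
  induction k generalizing j n with
  | zero =>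
    have : Antitone s := fun a b _ =>
      (congrArg s (Subsingleton.elim (α := Fin 1) b a)).le
    rw [truncTerm, if_neg fun h0 => h ⟨h0, this⟩]
  | succ k ih =>
    rw [truncTerm]
    by_cases h0 : s 0 ≤ n
    · rw [if_pos h0, ih, mul_zero, mul_zero]
      rintro ⟨h1, h2⟩
      refine h ⟨h0, Fin.antitone_iff_succ_le.mpr fun i => ?_⟩
      refine Fin.cases h1 (fun i => ?_) i
      exact Fin.antitone_iff_succ_le.mp h2 i
    · rw [if_neg h0]

theorem overpartitionTerm_zero (j : ℕ) (q z : ℂ) (s : Fin 1 → ℕ) :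
    overpartitionTerm 0 j q z s = q ^ (if 0 < j then s 0 ^ 2 - s 0 else s 0 ^ 2) *
      (qPoch (-z) q (s 0) * qPoch (-(q / z)) q (s 0) * qPochRecip q (2 * s 0)) := by
  simp [overpartitionTerm, qPochRecip, div_eq_mul_inv]

theorem overpartitionTerm_succ (k j : ℕ) (q z : ℂ) (s : Fin (k + 2) → ℕ) :
    overpartitionTerm (k + 1) j q z s = q ^ (if 0 < j then s 0 ^ 2 - s 0 else s 0 ^ 2) *
      (qPochRecip q (s 0 - s 1) * overpartitionTerm k (j - 1) q z (Fin.tail s)) := by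
  have h : ∀ i : Fin (k + 1), ((i.succ : ℕ) < j) = ((i : ℕ) < j - 1) := fun i => by
    rw [Fin.val_succ, Nat.lt_sub_iff_add_lt]
  rw [overpartitionTerm, overpartitionTerm, Fin.sum_univ_succ, Fin.prod_univ_succ, pow_add,
    qPochRecip]
  have h0 : (if ((0 : Fin (k + 2)) : ℕ) < j then s 0 ^ 2 - s 0 else s 0 ^ 2)
      = if 0 < j then s 0 ^ 2 - s 0 else s 0 ^ 2 := rfl
  rw [h0]
  simp only [h, Fin.tail, Fin.succ_last, Fin.castSucc_zero, Fin.succ_castSucc,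
    Fin.succ_zero_eq_one, div_eq_mul_inv, mul_inv]
  ring

theorem truncTerm_eq (q z : ℂ) {k : ℕ} (j n : ℕ) {s : Fin (k + 1) → ℕ} (h0 : s 0 ≤ n)
    (hs : Antitone s) : truncTerm z (q / z) q (k + 1) j n s
      = qPochRecip q (n - s 0) * overpartitionTerm k j q z s := by
  induction k generalizing j n with
  | zero => rw [truncTerm, if_pos h0, overpartitionTerm_zero, truncTerm]
  | succ k ih =>
    rw [truncTerm, if_pos h0, overpartitionTerm_succ,
      ih _ _ (s := Fin.tail s) (hs (Fin.zero_le _)) fun a b hab => hs (Fin.succ_le_succ_iff.mpr hab)]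
    rfl

/-- The bound is uniform in n, so it serves both summability and dominated convergence. -/
theorem norm_truncTerm_le {x y q : ℂ} {C D : ℝ} (hC : ∀ n, ‖qPochRecip q n‖ ≤ C)
    (hD : ∀ n, ‖qPoch (-x) q n * qPoch (-y) q n * qPochRecip q (2 * n)‖ ≤ D) (hq : ‖q‖ < 1)
    (m j n : ℕ) (s : Fin m → ℕ) :
    ‖truncTerm x y q m j n s‖ ≤ C ^ m * D * ∏ i, ‖q‖ ^ (s i ^ 2 - s i) := by
  have hC0 : 0 ≤ C := (norm_nonneg _).trans (hC 0)
  have hD0 : 0 ≤ D := (norm_nonneg _).trans (hD 0)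
  induction m generalizing j n with
  | zero => simpa [truncTerm] using hD n
  | succ m ih =>
    rw [truncTerm]
    by_cases h0 : s 0 ≤ n
    · rw [if_pos h0, norm_mul, norm_mul, norm_pow, Fin.prod_univ_succ]
      have h1 : ‖q‖ ^ (if 0 < j then s 0 ^ 2 - s 0 else s 0 ^ 2) ≤ ‖q‖ ^ (s 0 ^ 2 - s 0) := by
        refine pow_le_pow_of_le_one (norm_nonneg q) hq.le ?_
        split_ifs <;> omega
      calc _ ≤ C * (‖q‖ ^ (s 0 ^ 2 - s 0) *
            (C ^ m * D * ∏ i, ‖q‖ ^ (Fin.tail s i ^ 2 - Fin.tail s i))) := by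
            gcongr
            · exact hC _
            · exact ih _ _ _
        _ = _ := by
            simp only [Fin.tail]
            ring
    · rw [if_neg h0, norm_zero]
      positivity

theorem summable_prod_pow_sq_sub {t : ℝ} (ht0 : 0 ≤ t) (ht : t < 1) (m : ℕ) :
    Summable fun s : Fin m → ℕ => ∏ i, t ^ (s i ^ 2 - s i) := by
  induction m with
  | zero => exact Summable.of_finite
  | succ m ih =>
    have h1 : Summable fun n : ℕ => t ^ (n ^ 2 - n) := by
      -- The comparison n² - n ≥ n fails at n = 1.
      refine (summable_nat_add_iff 2).mp ?_
      refine Summable.of_nonneg_of_le (fun n => by positivity) (fun n => ?_)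
        (summable_geometric_of_lt_one ht0 ht)
      refine pow_le_pow_of_le_one ht0 ht.le ?_
      rw [show (n + 2) ^ 2 = n + (n ^ 2 + 2 * n + 2) + (n + 2) by ring, Nat.add_sub_cancel]
      exact Nat.le_add_right _ _
    rw [← (Fin.consEquiv fun _ : Fin (m + 1) => ℕ).summable_iff]
    have := h1.mul_of_nonneg ih (fun n => by positivity) (fun s => by positivity)
    refine this.congr fun p => ?_
    simp [Fin.prod_univ_succ, Fin.consEquiv]

/-- Peel off the largest variable: the inner sum is the induction hypothesis and the outer one a
single Bailey step. The weights q^(s²) are innermost, hence come first. -/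
theorem hasSum_truncTerm {x y q : ℂ} (hxy : x * y = q) {C D : ℝ} (hC : ∀ n, ‖qPochRecip q n‖ ≤ C)
    (hD : ∀ n, ‖qPoch (-x) q n * qPoch (-y) q n * qPochRecip q (2 * n)‖ ≤ D) (hq : ‖q‖ < 1)
    {m j : ℕ} (hj : j ≤ m) (n : ℕ) :
    HasSum (truncTerm x y q m j n) (baileySum x y q (m - j) j n) := by
  induction m generalizing j n with
  | zero =>
    obtain rfl : j = 0 := Nat.le_zero.mp hj
    have : baileySum x y q 0 0 n = truncTerm x y q 0 0 n default := by
      rw [truncTerm, qPoch_neg_mul_qPoch_neg hq hxy, baileySum]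
      simp [homogSum_zero, homogSumPred]
    rw [this]
    exact hasSum_unique _
  | succ m ih =>
    have hs : Summable (truncTerm x y q (m + 1) j n) :=
      ((summable_prod_pow_sq_sub (norm_nonneg q) hq (m + 1)).mul_left (C ^ (m + 1) * D)).of_norm_bounded
        (norm_truncTerm_le hC hD hq _ _ _)
    set e := Fin.consEquiv fun _ : Fin (m + 1) => ℕ
    have h1 := (e.hasSum_iff.mpr hs.hasSum).prod_fiberwise
      (g := fun a => if a ≤ n then qPochRecip q (n - a) *
        (q ^ (if 0 < j then a ^ 2 - a else a ^ 2) * baileySum x y q (m - (j - 1)) (j - 1) a) else 0)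
      (fun a => by
        have hf : ∀ b : Fin m → ℕ, truncTerm x y q (m + 1) j n (e (a, b))
            = if a ≤ n then qPochRecip q (n - a) * (q ^ (if 0 < j then a ^ 2 - a else a ^ 2) *
              truncTerm x y q m (j - 1) a b) else 0 := fun b => by
          rw [truncTerm]
          rfl
        simp only [Function.comp_apply, hf]
        split_ifs
        · exact ((ih (by omega) a).mul_left _).mul_left _
        · exact ((ih (by omega) a).mul_left _).mul_left _
        · exact hasSum_zero)
    have h2 := hasSum_sum_of_ne_finset_zero (L := SummationFilter.unconditional ℕ) (s := Finset.range (n + 1))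
      (f := fun a => if a ≤ n then qPochRecip q (n - a) *
        (q ^ (if 0 < j then a ^ 2 - a else a ^ 2) * baileySum x y q (m - (j - 1)) (j - 1) a) else 0)
      (fun a ha => if_neg (by simpa [Nat.lt_succ_iff] using ha))
    have h3 : ∑ a ∈ Finset.range (n + 1), (if a ≤ n then qPochRecip q (n - a) *
        (q ^ (if 0 < j then a ^ 2 - a else a ^ 2) * baileySum x y q (m - (j - 1)) (j - 1) a) else 0)
        = baileySum x y q (m + 1 - j) j n := by
      rw [Finset.sum_congr rfl fun a ha => if_pos (Nat.lt_succ_iff.mp (Finset.mem_range.mp ha))]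
      rcases j with _ | j
      · simpa using sum_pow_sq_mul_baileySum hq x y m n
      · simpa using sum_pow_sq_sub_mul_baileySum hq x y (m - j) j n
    rw [h3] at h2
    rw [← h1.unique h2]
    exact hs.hasSum

/-! ### Passage to the limit -/

theorem tendsto_qPoch (A : ℂ) {q : ℂ} (hq : ‖q‖ < 1) :
    Tendsto (qPoch A q) atTop (𝓝 (qPochInf A q)) :=
  (multipliable_qPochInf A q hq).hasProd.tendsto_prod_nat

theorem qPochInf_self_ne_zero {q : ℂ} (hq : ‖q‖ < 1) : qPochInf q q ≠ 0 := by
  have h := tprod_one_add_ne_zero_of_summable (f := fun i : ℕ => -(q * q ^ i)) (fun i => ?_) ?_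
  · simpa only [qPochInf, ← sub_eq_add_neg] using h
  · rw [← sub_eq_add_neg, ← pow_succ']
    exact one_sub_pow_succ_ne_zero hq i
  · simpa [norm_mul, norm_pow] using
      (summable_geometric_of_lt_one (norm_nonneg q) hq).mul_left ‖q‖

theorem tendsto_qPochRecip {q : ℂ} (hq : ‖q‖ < 1) :
    Tendsto (qPochRecip q) atTop (𝓝 (qPochInf q q)⁻¹) :=
  (tendsto_qPoch q hq).inv₀ (qPochInf_self_ne_zero hq)

theorem exists_norm_le_of_tendsto {u : ℕ → ℂ} {a : ℂ} (h : Tendsto u atTop (𝓝 a)) :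
    ∃ C, ∀ n, ‖u n‖ ≤ C := by
  obtain ⟨C, hC⟩ := (Metric.isBounded_range_of_tendsto u h).exists_norm_le
  exact ⟨C, fun n => hC _ ⟨n, rfl⟩⟩

theorem tendsto_baileyKernel {q : ℂ} (hq : ‖q‖ < 1) (r : ℕ) :
    Tendsto (baileyKernel q r) atTop (𝓝 ((qPochInf q q)⁻¹ * (qPochInf q q)⁻¹)) := by
  have h := tendsto_qPochRecip hq
  refine ((h.comp (tendsto_sub_atTop_nat r)).mul (h.comp (tendsto_add_atTop_nat r))).congr' ?_
  filter_upwards [eventually_ge_atTop r] with n hn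
  exact (if_pos hn).symm

theorem norm_baileyKernel_le {q : ℂ} {C : ℝ} (hC : ∀ n, ‖qPochRecip q n‖ ≤ C) (r n : ℕ) :
    ‖baileyKernel q r n‖ ≤ C * C := by
  have hC0 : 0 ≤ C := (norm_nonneg _).trans (hC 0)
  rw [baileyKernel]
  split_ifs
  · rw [norm_mul]
    exact mul_le_mul (hC _) (hC _) (norm_nonneg _) hC0
  · rw [norm_zero]
    positivity

theorem summable_norm_pow_choose_two_mul_pow (x : ℂ) {q : ℂ} (hq : ‖q‖ < 1) :
    Summable fun r : ℕ => ‖q ^ r.choose 2 * x ^ r‖ := by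
  have h : Tendsto (fun r : ℕ => ‖q‖ ^ r * ‖x‖) atTop (𝓝 0) := by
    simpa using (tendsto_pow_atTop_nhds_zero_of_lt_one (norm_nonneg q) hq).mul_const ‖x‖
  refine summable_of_ratio_norm_eventually_le (r := 1 / 2) (by norm_num) ?_
  filter_upwards [h.eventually (ge_mem_nhds (show (0 : ℝ) < 1 / 2 by norm_num))] with r hr
  rw [norm_norm, norm_norm, Nat.choose_succ_succ' r 1, Nat.choose_one_right,
    show q ^ (r + r.choose 2) * x ^ (r + 1) = (q ^ r * x) * (q ^ r.choose 2 * x ^ r) by ring,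
    norm_mul, norm_mul (q ^ r), norm_pow]
  exact mul_le_mul_of_nonneg_right hr (norm_nonneg _)

theorem summable_norm_thetaCoeff (x y : ℂ) {q : ℂ} (hq : ‖q‖ < 1) :
    Summable fun r => ‖thetaCoeff x y q r‖ := by
  refine (summable_nat_add_iff 1).mp ?_
  refine Summable.of_nonneg_of_le (fun _ => norm_nonneg _) (fun r => ?_)
    ((summable_nat_add_iff 1).mpr ((summable_norm_pow_choose_two_mul_pow x hq).add
      (summable_norm_pow_choose_two_mul_pow y hq)))
  rw [thetaCoeff_succ, mul_add]
  exact norm_add_le _ _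

/-- Dominated convergence: for fixed r the `d` part dies with q^n. -/
theorem tendsto_sum_mul_baileyKernel {q : ℂ} (hq : ‖q‖ < 1) {a b d : ℕ → ℂ} {B D : ℝ}
    (ha : Summable fun r => ‖a r‖) (hb : ∀ r, ‖b r‖ ≤ B) (hd : ∀ r, ‖d r‖ ≤ D) :
    Tendsto (fun n => ∑ r ∈ Finset.range (n + 1), a r * (b r - q ^ n * d r) * baileyKernel q r n)
      atTop (𝓝 ((∑' r, a r * b r) * ((qPochInf q q)⁻¹ * (qPochInf q q)⁻¹))) := by
  obtain ⟨C, hC⟩ := exists_norm_le_of_tendsto (tendsto_qPochRecip hq)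
  have hB : 0 ≤ B := (norm_nonneg _).trans (hb 0)
  have hD : 0 ≤ D := (norm_nonneg _).trans (hd 0)
  rw [← tsum_mul_right]
  have hf : ∀ n, ∑ r ∈ Finset.range (n + 1), a r * (b r - q ^ n * d r) * baileyKernel q r n
      = ∑' r, a r * (b r - q ^ n * d r) * baileyKernel q r n := fun n => by
    rw [tsum_eq_sum fun r hr => ?_]
    rw [baileyKernel_of_lt (by simpa [Nat.lt_succ_iff] using hr), mul_zero]
  simp only [hf]
  refine tendsto_tsum_of_dominated_convergence
    (bound := fun r => ‖a r‖ * (B + D) * (C * C)) ((ha.mul_right _).mul_right _) (fun r => ?_)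
    (Eventually.of_forall fun n r => ?_)
  · have h0 : Tendsto (fun n => a r * (b r - q ^ n * d r)) atTop (𝓝 (a r * (b r - 0 * d r))) :=
      ((tendsto_const_nhds.sub
        ((tendsto_pow_atTop_nhds_zero_of_norm_lt_one hq).mul_const _)).const_mul _)
    rw [zero_mul, sub_zero] at h0
    exact h0.mul (tendsto_baileyKernel hq r)
  · rw [norm_mul, norm_mul]
    have h1 : ‖b r - q ^ n * d r‖ ≤ B + D := by
      refine (norm_sub_le _ _).trans (add_le_add (hb r) ?_)
      rw [norm_mul, norm_pow]
      exact (mul_le_of_le_one_left (norm_nonneg _) (pow_le_one₀ (norm_nonneg q) hq.le)).trans (hd r)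
    gcongr
    exact norm_baileyKernel_le hC r n

/-- **Jacobi's triple product identity**, with the terms of index `r` and `-r` taken together. -/
theorem hasSum_thetaCoeff {x y q : ℂ} (hq : ‖q‖ < 1) (hxy : x * y = q) :
    HasSum (thetaCoeff x y q) (qPochInf (-x) q * qPochInf (-y) q * qPochInf q q) := by
  have hs := summable_norm_thetaCoeff x y hq
  have h1 := tendsto_sum_mul_baileyKernel hq (b := fun _ => 1) (d := fun _ => 0) (B := 1) (D := 0)
    hs (by simp) (by simp)
  simp only [mul_zero, sub_zero, mul_one, ← qPoch_neg_mul_qPoch_neg hq hxy] at h1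
  -- The same sequence, now in product form.
  have h2 := ((tendsto_qPoch (-x) hq).mul (tendsto_qPoch (-y) hq)).mul
    ((tendsto_qPochRecip hq).comp (tendsto_id.const_mul_atTop' two_pos))
  have h3 := tendsto_nhds_unique h2 h1
  have hne := qPochInf_self_ne_zero hq
  have h4 : ∑' r, thetaCoeff x y q r = qPochInf (-x) q * qPochInf (-y) q * qPochInf q q := by
    field_simp at h3
    exact h3.symm
  rw [← h4]
  exact hs.of_norm.hasSum

theorem norm_homogSum_le {q : ℂ} (hq : ‖q‖ < 1) (r j : ℕ) : ‖homogSum q r j‖ ≤ j + 1 := by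
  refine (norm_sum_le _ _).trans ((Finset.sum_le_card_nsmul _ _ 1 fun i _ => ?_).trans ?_)
  · rw [← pow_mul, ← pow_mul, ← pow_add, norm_pow]
    exact pow_le_one₀ (norm_nonneg q) hq.le
  · simp

theorem norm_homogSumPred_le {q : ℂ} (hq : ‖q‖ < 1) (r j : ℕ) : ‖homogSumPred q r j‖ ≤ j := by
  rcases j with _ | j
  · simp [homogSumPred]
  · rw [homogSumPred, norm_mul, norm_pow, Nat.cast_succ]
    exact (mul_le_of_le_one_left (norm_nonneg _) (pow_le_one₀ (norm_nonneg q) hq.le)).trans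
      (norm_homogSum_le hq r j)

theorem tendsto_baileySum {q : ℂ} (hq : ‖q‖ < 1) (x y : ℂ) (e j : ℕ) :
    Tendsto (baileySum x y q e j) atTop
      (𝓝 ((∑' r, thetaCoeff x y q r * (q ^ (e * r ^ 2) * homogSum q r j))
        * ((qPochInf q q)⁻¹ * (qPochInf q q)⁻¹))) := by
  have h : ∀ {w : ℂ} (m : ℕ), ‖q ^ m * w‖ ≤ ‖w‖ := fun m => by
    rw [norm_mul, norm_pow]
    exact mul_le_of_le_one_left (norm_nonneg _) (pow_le_one₀ (norm_nonneg q) hq.le)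
  exact tendsto_sum_mul_baileyKernel hq (summable_norm_thetaCoeff x y hq)
    (fun r => (h _).trans (norm_homogSum_le hq r j))
    (fun r => (h _).trans (norm_homogSumPred_le hq r j))

/-! ### Splitting into theta series, and the theorem -/

theorem sum_thetaCoeff_eq {k j : ℕ} (hj : j ≤ k + 1) (q z : ℂ) (r : ℕ) :
    ∑ s ∈ Finset.range (j + 1), thetaCoeff (z * q ^ (k + 1 + j - 2 * s))
        (q ^ (k + 2 - j + 2 * s) / z) (q ^ (2 * k + 3)) r
      = thetaCoeff z (q / z) q r * (q ^ ((k + 1 - j) * r ^ 2) * homogSum q r j) := by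
  rcases Nat.eq_zero_or_pos r with rfl | hr
  · simp [thetaCoeff, homogSum]
  obtain ⟨e, he⟩ := Nat.exists_eq_add_of_le' hj
  have hc : r ^ 2 = 2 * r.choose 2 + r := by
    obtain ⟨t, rfl⟩ := Nat.exists_eq_succ_of_ne_zero hr.ne'
    rw [Nat.choose_two_right, Nat.mul_div_cancel' (Nat.even_mul_pred_self _).two_dvd,
      Nat.succ_sub_one, Nat.succ_eq_add_one]
    ring
  rw [show k + 1 - j = e by omega, show k + 2 - j = e + 1 by omega, he,
    show 2 * k + 3 = 2 * (e + j) + 1 by omega, homogSum, hc, Nat.add_sub_cancel]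
  simp only [thetaCoeff, hr.ne', if_false]
  generalize r.choose 2 = c
  have h1 : ∀ s ∈ Finset.range (j + 1), (z * q ^ (e + j + j - 2 * s)) ^ r
      = z ^ r * q ^ ((e + 2 * (j - s)) * r) := fun s hs => by
    have : s ≤ j := Nat.lt_succ_iff.mp (Finset.mem_range.mp hs)
    rw [show e + j + j - 2 * s = e + 2 * (j - s) by omega, mul_pow, ← pow_mul]
  -- The monomial A^i B^(j-i) matches z^r at s = i but z^(-r) at s = j - i, so the identity holds
  -- only after summing over s.
  have h2 : ∑ s ∈ Finset.range (j + 1), (q ^ (e + 1 + 2 * s) / z) ^ r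
      = ∑ s ∈ Finset.range (j + 1), q ^ ((e + 1 + 2 * (j - s)) * r) / z ^ r := by
    rw [← Finset.sum_flip]
    exact Finset.sum_congr rfl fun s _ => by rw [div_pow, ← pow_mul]
  rw [← Finset.mul_sum, Finset.sum_add_distrib, Finset.sum_congr rfl h1, h2,
    ← Finset.sum_add_distrib, Finset.mul_sum, Finset.mul_sum, Finset.mul_sum]
  refine Finset.sum_congr rfl fun s hs => ?_
  obtain ⟨i, rfl⟩ := Nat.exists_eq_add_of_le (Nat.lt_succ_iff.mp (Finset.mem_range.mp hs))
  rw [Nat.add_sub_cancel_left, div_pow]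
  ring

theorem mainTheorem6 (k j : ℕ) (hj : j ≤ k + 1) (q z : ℂ) (hq : ‖q‖ < 1) (hz : z ≠ 0) :
    HasSum
      (fun s : {s : Fin (k + 1) → ℕ // Antitone s} => overpartitionTerm k j q z s.1)
      (∑ s ∈ Finset.range (j + 1),
        qPochInf (-(z * q ^ (k + 1 + j - 2 * s))) (q ^ (2 * k + 3))
          * qPochInf (-(q ^ (k + 2 - j + 2 * s) / z)) (q ^ (2 * k + 3))
          * qPochInf (q ^ (2 * k + 3)) (q ^ (2 * k + 3))
          / qPochInf q q) := by
  have hxy : z * (q / z) = q := mul_div_cancel₀ q hz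
  have hne := qPochInf_self_ne_zero hq
  obtain ⟨C, hC⟩ := exists_norm_le_of_tendsto (tendsto_qPochRecip hq)
  obtain ⟨D, hD⟩ := exists_norm_le_of_tendsto
    (((tendsto_qPoch (-z) hq).mul (tendsto_qPoch (-(q / z)) hq)).mul
      ((tendsto_qPochRecip hq).comp (tendsto_id.const_mul_atTop' two_pos)))
  have hbound : Summable fun s : {s : Fin (k + 1) → ℕ // Antitone s} =>
      C ^ (k + 1) * D * ∏ i, ‖q‖ ^ (s.1 i ^ 2 - s.1 i) :=
    ((summable_prod_pow_sq_sub (norm_nonneg q) hq (k + 1)).mul_left _).subtype _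
  have hterm : Summable fun s : {s : Fin (k + 1) → ℕ // Antitone s} =>
      overpartitionTerm k j q z s.1 := by
    refine hbound.of_norm_bounded fun s => ?_
    -- Truncating at n = s_1 gives the untruncated term, as 1/(q)_0 = 1.
    have h := truncTerm_eq q z j (s.1 0) le_rfl s.2
    rw [Nat.sub_self, qPochRecip_zero, one_mul] at h
    rw [← h]
    exact norm_truncTerm_le hC hD hq _ _ _ _
  have hsum : ∀ n, ∑' s : {s : Fin (k + 1) → ℕ // Antitone s},
      truncTerm z (q / z) q (k + 1) j n s.1 = baileySum z (q / z) q (k + 1 - j) j n := fun n =>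
    ((hasSum_subtype_iff_of_support_subset (s := {s | Antitone s}) fun s hs => by
      by_contra h
      exact hs (truncTerm_eq_zero _ _ _ _ _ fun h' => h h'.2)).mpr
        (hasSum_truncTerm hxy hC hD hq hj n)).tsum_eq
  have hlim : Tendsto (fun n => ∑' s : {s : Fin (k + 1) → ℕ // Antitone s},
      truncTerm z (q / z) q (k + 1) j n s.1) atTop
      (𝓝 (∑' s : {s : Fin (k + 1) → ℕ // Antitone s},
        (qPochInf q q)⁻¹ * overpartitionTerm k j q z s.1)) := by
    refine tendsto_tsum_of_dominated_convergence hbound (fun s => ?_)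
      (Eventually.of_forall fun n s => norm_truncTerm_le hC hD hq _ _ _ _)
    refine (((tendsto_qPochRecip hq).comp (tendsto_sub_atTop_nat (s.1 0))).mul_const _).congr' ?_
    filter_upwards [eventually_ge_atTop (s.1 0)] with n hn
    exact (truncTerm_eq q z j n hn s.2).symm
  simp only [hsum, tsum_mul_left] at hlim
  have heq := tendsto_nhds_unique hlim (tendsto_baileySum hq z (q / z) (k + 1 - j) j)
  have hQ : ‖q ^ (2 * k + 3)‖ < 1 := by
    rw [norm_pow]
    exact pow_lt_one₀ (norm_nonneg q) hq (by omega)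
  have htheta := hasSum_sum (s := Finset.range (j + 1)) fun s hs =>
    hasSum_thetaCoeff (x := z * q ^ (k + 1 + j - 2 * s)) (y := q ^ (k + 2 - j + 2 * s) / z) hQ (by
      -- The exponents add up to 2k + 3; no subtraction truncates, as s ≤ j ≤ k + 1.
      have hs' := Finset.mem_range.mp hs
      rw [← mul_div_assoc, mul_assoc, ← pow_add, mul_div_cancel_left₀ _ hz]
      congr 1
      omega)
  simp only [sum_thetaCoeff_eq hj] at htheta
  rw [htheta.tsum_eq] at heq
  rw [← Finset.sum_div]
  convert hterm.hasSum using 1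
  rw [div_eq_mul_inv]
  apply mul_left_cancel₀ (inv_ne_zero hne)
  rw [heq]
  ring
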